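/- Let $\lambda$ be a Young diagram with $n$ boxes. For a box $\Box$ let $r(\Box)$ and $c(\Box)$ denote its row and its column (the rows being numbered so that their lengths weakly decrease). Let $S_n$ be the group of permutations of $\{1,\dots,n\}$ and $\tilde S_n$ the group of permutations of the boxes of $\lambda$. Let $a_\lambda=\sum_{\sigma}\sigma$, summed over all $\sigma\in\tilde S_n$ preserving each row, and $b_\lambda=\sum_\sigma \operatorname{sgn}(\sigma)\,\sigma$, summed over all $\sigma\in\tilde S_n$ preserving each column, and let $\rho^\lambda$ be the representation of $\tilde S_n$ associated with $\lambda$, i.e. the left multiplication on $\mathbb{C}[\tilde S_n]\,b_\lambda a_\lambda$. It is regarded as a representation of $S_n$ by means of any bijection $T$ between $\{1,\dots,n\}$ and the boxes of $\lambda$. Let $$\chi^\lambda(\pi)=\frac{\operatorname{Tr}\rho^\lambda(\pi)}{\operatorname{Tr}\rho^\lambda(e)}$$ be the character rescaled so that $\chi^\lambda(e)=1$. For $\sigma\in\tilde S_n$ such that $\sigma(\Box_1),\sigma(\Box_2)$ are in different columns whenever $\Box_1\neq\Box_2$ are boxes in the same row, let $\operatorname{inv}(\sigma)$ be the number of pairs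 $(\Box_1,\Box_2)$ of boxes such that $\sigma(\Box_1),\sigma(\Box_2)$ are in the same column, $r(\Box_1)<r(\Box_2)$ and $r(\sigma(\Box_1))>r(\sigma(\Box_2))$. For $\sigma\in\tilde S_n$ which do not have this property put $(-1)^{\operatorname{inv}(\sigma)}:=0$. **Theorem.** Let $\pi\in S_n$ and let $\hat\pi$ be a random element of $\tilde S_n$ with the uniform distribution on the conjugacy class $\{f\pi f^{-1} : f \text{ a bijection from } \{1,\dots,n\} \text{ to the boxes of } \lambda\}$ defined by $\pi$. Then, for every choice of $T$, $$\chi^\lambda(\pi)=\mathbb{E}\bigl[(-1)^{\operatorname{inv}(\hat\pi)}\bigr].$$ -/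

import Mathlib

open MeasureTheory ProbabilityTheory

noncomputable section

namespace YoungDiagram

/-- The boxes of a Young diagram; `x.1.1` is the (number of the) row and `x.1.2` the column
of the box `x`, both numbered from `0`, row `0` being the longest one. -/
abbrev Box (lam : YoungDiagram) : Type := {x : ℕ × ℕ // x ∈ lam.cells}

/-- The row `r(x)` of a box. -/
def Box.rowIdx {lam : YoungDiagram} (x : lam.Box) : ℕ := x.1.1

/-- The column `c(x)` of a box. -/
def Box.colIdx {lam : YoungDiagram} (x : lam.Box) : ℕ := x.1.2

/-! ### The representation associated with a Young diagram -/

/-- The row symmetrizer: the sum in the group algebra of all permutations of the boxes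
which preserve each row. -/
def rowSymmetrizer (lam : YoungDiagram) : MonoidAlgebra ℂ (Equiv.Perm lam.Box) :=
  ∑ σ : Equiv.Perm lam.Box with ∀ x, (σ x).rowIdx = x.rowIdx,
    MonoidAlgebra.of ℂ (Equiv.Perm lam.Box) σ

/-- The column antisymmetrizer: the signed sum in the group algebra of all permutations of the
boxes which preserve each column. -/
def colAntisymmetrizer (lam : YoungDiagram) : MonoidAlgebra ℂ (Equiv.Perm lam.Box) :=
  ∑ σ : Equiv.Perm lam.Box with ∀ x, (σ x).colIdx = x.colIdx,
    ((Equiv.Perm.sign σ : ℤ) : ℂ) • MonoidAlgebra.of ℂ (Equiv.Perm lam.Box) σ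

/-- The Young symmetrizer `c = b * a`. -/
def youngSymmetrizer (lam : YoungDiagram) : MonoidAlgebra ℂ (Equiv.Perm lam.Box) :=
  lam.colAntisymmetrizer * lam.rowSymmetrizer

/-- The left ideal `ℂ[G] c`, the image of the right multiplication by the Young symmetrizer. -/
def irrepSpace (lam : YoungDiagram) :
    Submodule ℂ (MonoidAlgebra ℂ (Equiv.Perm lam.Box)) :=
  LinearMap.range (LinearMap.mulRight ℂ lam.youngSymmetrizer)

theorem irrepSpace_invariant (lam : YoungDiagram) (g : Equiv.Perm lam.Box) :
    lam.irrepSpace ≤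
      lam.irrepSpace.comap (Representation.leftRegular ℂ (Equiv.Perm lam.Box) g) := by
  rintro _ ⟨y, rfl⟩
  have h : ∀ z : MonoidAlgebra ℂ (Equiv.Perm lam.Box),
      Representation.leftRegular ℂ (Equiv.Perm lam.Box) g z = MonoidAlgebra.of ℂ _ g * z := by
    intro z
    rw [← Representation.asAlgebraHom_ofMulAction_smul_eq_mul, Representation.asAlgebraHom_of]
  refine ⟨MonoidAlgebra.of ℂ _ g * y, ?_⟩
  rw [h]
  simp [mul_assoc]

/-- The irreducible representation `ρ^λ` of the group of permutations of the boxes: the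
permutations act on `ℂ[G] c` by multiplication from the left. -/
def irrep (lam : YoungDiagram) : Representation ℂ (Equiv.Perm lam.Box) lam.irrepSpace :=
  (Representation.leftRegular ℂ (Equiv.Perm lam.Box)).subrepresentation lam.irrepSpace
    lam.irrepSpace_invariant

/-- The rescaled character `χ^λ(π) = Tr ρ^λ(π) / Tr ρ^λ(e)` of a permutation `π` of
`n` elements, where `S_n` acts on the space of `ρ^λ` through a numbering `T` of the boxes. -/
def normalizedCharacter (lam : YoungDiagram) {n : ℕ} (T : Fin n ≃ lam.Box)
    (π : Equiv.Perm (Fin n)) : ℂ :=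
  lam.irrep.character (T.permCongr π) / lam.irrep.character 1

/-! ### Column inversions -/

/-- Any two distinct boxes in the same row are sent to boxes in distinct columns. -/
def SeparatesRows {lam : YoungDiagram} (σ : Equiv.Perm lam.Box) : Prop :=
  ∀ x y : lam.Box, x ≠ y → x.rowIdx = y.rowIdx → (σ x).colIdx ≠ (σ y).colIdx

/-- The number of column inversions of `σ`. -/
def inv {lam : YoungDiagram} (σ : Equiv.Perm lam.Box) : ℕ :=
  Finset.card {p : lam.Box × lam.Box | (σ p.1).colIdx = (σ p.2).colIdx ∧
    p.1.rowIdx < p.2.rowIdx ∧ (σ p.2).rowIdx < (σ p.1).rowIdx}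

open Classical in
/-- The quantity `(-1)^{inv σ}`, understood as `0` if two distinct boxes in the same row are
sent to the same column. -/
def invSign {lam : YoungDiagram} (σ : Equiv.Perm lam.Box) : ℝ :=
  if SeparatesRows σ then (-1) ^ inv σ else 0

/-- The conjugacy class of permutations of the boxes defined by `π ∈ S_n`: all the permutations
obtained from `π` by replacing, in some bijective way, the elements `1, …, n` by the boxes. -/
def boxConjClass (lam : YoungDiagram) {n : ℕ} (π : Equiv.Perm (Fin n)) :
    Set (Equiv.Perm lam.Box) :=
  {σ | ∃ f : Fin n ≃ lam.Box, σ = f.permCongr π}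

end YoungDiagram

end

namespace Equiv.Perm

/-! The coefficient of `σ` in the Young symmetrizer `c = b * a` is `(-1)^{inv σ}`
(`coeff_youngSymmetrizer`): `σ` separates rows exactly when `σ = q * p` with `q` preserving columns
and `p` preserving rows, the factorization is unique, and `sign q` is the parity of `inv σ`.

Moreover `c * c = k • c`, so `y ↦ g * y * c` has trace `k` times the character at `g`. In the basis
of group elements the same trace is the sum of coefficients of `c` over conjugates of `g⁻¹`
(`mul_character_irrep`). At `g = 1` it is `n!`, hence `k ≠ 0`; dividing gives an average over the
conjugacy class of `g⁻¹`, which is that of `g`. -/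

theorem sign_fin_eq_neg_one_pow_card {n : ℕ} (σ : Perm (Fin n)) :
    sign σ = (-1) ^ Finset.card {p : Fin n × Fin n | p.1 < p.2 ∧ σ p.2 < σ p.1} := by
  have h : ∀ j : Fin n, (∏ i ∈ Finset.Iio j, (if σ i < σ j then 1 else -1 : ℤˣ)) =
      ∏ i, if i < j ∧ σ j < σ i then -1 else 1 := by
    intro j
    rw [← Finset.prod_subset (Finset.subset_univ (Finset.Iio j))]
    · refine Finset.prod_congr rfl fun i hi => ?_
      have hij : i < j := Finset.mem_Iio.1 hi
      have hne : σ i ≠ σ j := fun h => hij.ne (σ.injective h)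
      rcases lt_or_gt_of_ne hne with h | h
      · simp [h, h.not_gt]
      · simp [h, h.not_gt, hij]
    · intro i _ hi
      rw [if_neg]
      exact fun h => hi (Finset.mem_Iio.2 h.1)
  rw [sign_eq_prod_prod_Iio, Finset.prod_congr rfl fun j _ => h j, Finset.prod_comm,
    ← Fintype.prod_prod_type', Finset.prod_ite, Finset.prod_const, Finset.prod_const_one, mul_one]

/-- The sign of a permutation counts inversions, for the order induced by any injection into a
linear order. -/
theorem sign_eq_neg_one_pow_card {α β : Type*} [Fintype α] [DecidableEq α] [LinearOrder β]
    {f : α → β} (hf : Function.Injective f) (σ : Perm α) :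
    sign σ = (-1) ^ Finset.card {p : α × α | f p.1 < f p.2 ∧ f (σ p.2) < f (σ p.1)} := by
  have key : ∃ e : Fin (Fintype.card α) ≃ α, ∀ i j, f (e i) < f (e j) ↔ i < j := by
    let _ := LinearOrder.lift' f hf
    let e : Fin (Fintype.card α) ≃o α := (Fintype.orderIsoFinOfCardEq α rfl)
    exact ⟨e.toEquiv, fun i j => e.lt_iff_lt⟩
  obtain ⟨e, he⟩ := key
  rw [← sign_permCongr e.symm σ, sign_fin_eq_neg_one_pow_card]
  congr 1
  refine Finset.card_equiv (e.prodCongr e) fun p => ?_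
  simp [← he, Equiv.permCongr_apply]

end Equiv.Perm

/-! ### Row-separating permutations and their factorization -/

namespace YoungDiagram

variable {lam : YoungDiagram}

theorem Box.ext_idx {x y : lam.Box} (hr : x.rowIdx = y.rowIdx) (hc : x.colIdx = y.colIdx) :
    x = y :=
  Subtype.ext (Prod.ext hr hc)

/-- The sign of a column preserving permutation counts the inversions within the columns. -/
theorem sign_eq_of_colIdx_eq {q : Equiv.Perm lam.Box} (hq : ∀ x, (q x).colIdx = x.colIdx) :
    Equiv.Perm.sign q = (-1) ^ Finset.card {p : lam.Box × lam.Box | p.1.colIdx = p.2.colIdx ∧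
      p.1.rowIdx < p.2.rowIdx ∧ (q p.2).rowIdx < (q p.1).rowIdx} := by
  have hf : Function.Injective fun x : lam.Box => toLex (x.colIdx, x.rowIdx) := by
    intro x y h
    have h' := congrArg ofLex h
    simp only [ofLex_toLex, Prod.mk.injEq] at h'
    exact Box.ext_idx h'.2 h'.1
  rw [Equiv.Perm.sign_eq_neg_one_pow_card hf]
  congr 2
  ext p
  simp only [Finset.mem_filter, Finset.mem_univ, true_and, Prod.Lex.toLex_lt_toLex, hq]
  omega

theorem separatesRows_mul {q p : Equiv.Perm lam.Box} (hq : ∀ x, (q x).colIdx = x.colIdx)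
    (hp : ∀ x, (p x).rowIdx = x.rowIdx) : SeparatesRows (q * p) := by
  intro x y hxy hr hc
  simp only [Equiv.Perm.mul_apply, hq] at hc
  exact hxy (p.injective (Box.ext_idx (by rw [hp, hp, hr]) hc))

/-- `p` only relabels boxes within rows, so it carries the column inversions of `q * p` to those of
`q`. -/
theorem invSign_mul {q p : Equiv.Perm lam.Box} (hq : ∀ x, (q x).colIdx = x.colIdx)
    (hp : ∀ x, (p x).rowIdx = x.rowIdx) :
    invSign (q * p) = ((Equiv.Perm.sign q : ℤ) : ℝ) := by
  rw [invSign, if_pos (separatesRows_mul hq hp), sign_eq_of_colIdx_eq hq]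
  push_cast
  congr 1
  refine Finset.card_equiv (p.prodCongr p) fun z => ?_
  simp [hq, hp]

theorem invSign_one : invSign (1 : Equiv.Perm lam.Box) = 1 := by
  have h := invSign_mul (lam := lam) (q := 1) (p := 1) (fun _ => rfl) (fun _ => rfl)
  simpa using h

theorem card_row_colIdx_lt_le {σ : Equiv.Perm lam.Box} (hσ : SeparatesRows σ) (i k : ℕ) :
    Finset.card {x : lam.Box | x.rowIdx = i ∧ (σ x).colIdx < k} ≤
      Finset.card {x : lam.Box | x.rowIdx = i ∧ x.colIdx < k} := by
  by_cases h : ∃ x : lam.Box, x.rowIdx = i ∧ k ≤ x.colIdx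
  · obtain ⟨x, hx, hk⟩ := h
    have h1 : Finset.card {x : lam.Box | x.rowIdx = i ∧ (σ x).colIdx < k} ≤
        (Finset.range k).card := by
      refine Finset.card_le_card_of_injOn (fun x => (σ x).colIdx) (fun y hy => ?_) ?_
      · simp at hy
        simpa using hy.2
      · intro y hy z hz hyz
        simp at hy hz
        by_contra hne
        exact hσ y z hne (hy.1.trans hz.1.symm) hyz
    refine h1.trans ?_
    have hmem : ∀ j < k, (i, j) ∈ lam.cells := fun j hj =>
      lam.isLowerSet (a := x.1) (Prod.mk_le_mk.2 ⟨hx.ge, (hj.trans_le hk).le⟩) x.2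
    refine Finset.card_le_card_of_injOn
      -- The value `x` is a dummy: only `j < k` is used.
      (fun j => if h : j < k then ⟨(i, j), hmem j h⟩ else x) (fun j hj => ?_) ?_
    · have hj : j < k := by simpa using hj
      beta_reduce
      rw [dif_pos hj]
      exact Finset.mem_coe.2 (Finset.mem_filter.2 ⟨Finset.mem_univ _, rfl, hj⟩)
    · intro a ha b hb hab
      have ha : a < k := by simpa using ha
      have hb : b < k := by simpa using hb
      simpa [ha, hb] using hab
  · push Not at h
    refine Finset.card_le_card fun x hx => ?_
    simp at hx ⊢
    exact ⟨hx.1, h x hx.1⟩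

/-- Summed over rows, both sides count the boxes in the first `k` columns, so every rowwise
inequality is an equality. -/
theorem card_row_colIdx_lt {σ : Equiv.Perm lam.Box} (hσ : SeparatesRows σ) (i k : ℕ) :
    Finset.card {x : lam.Box | x.rowIdx = i ∧ (σ x).colIdx < k} =
      Finset.card {x : lam.Box | x.rowIdx = i ∧ x.colIdx < k} := by
  classical
  by_cases hi : i ∈ Finset.univ.image (Box.rowIdx (lam := lam))
  swap
  · have : ∀ x : lam.Box, x.rowIdx ≠ i := by simpa using hi
    simp [this]
  have h1 : Finset.card {x : lam.Box | (σ x).colIdx < k} =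
      Finset.card {x : lam.Box | x.colIdx < k} :=
    Finset.card_equiv σ fun x => by simp
  have fib : ∀ s : Finset lam.Box,
      s.card = ∑ i ∈ Finset.univ.image (Box.rowIdx (lam := lam)), (s.filter (·.rowIdx = i)).card :=
    fun s => Finset.card_eq_sum_card_fiberwise fun x _ => by simp
  rw [fib, fib {x : lam.Box | x.colIdx < k}] at h1
  simp only [Finset.filter_filter] at h1
  have h2 := (Finset.sum_eq_sum_iff_of_le fun i _ => ?_).1 h1 i hi
  · simpa only [and_comm] using h2
  · simpa only [and_comm] using card_row_colIdx_lt_le hσ i k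

/-- Comparing the counts for `k` and `k + 1` at `k = (σ x).colIdx`: without such a box only the
count for `σ` would grow. -/
theorem exists_rowIdx_colIdx {σ : Equiv.Perm lam.Box} (hσ : SeparatesRows σ) (x : lam.Box) :
    ∃ y : lam.Box, y.rowIdx = x.rowIdx ∧ y.colIdx = (σ x).colIdx := by
  by_contra! hne
  have h0 := card_row_colIdx_lt hσ x.rowIdx (σ x).colIdx
  have h1 := card_row_colIdx_lt hσ x.rowIdx ((σ x).colIdx + 1)
  have h2 : Finset.card {y : lam.Box | y.rowIdx = x.rowIdx ∧ y.colIdx < (σ x).colIdx + 1} =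
      Finset.card {y : lam.Box | y.rowIdx = x.rowIdx ∧ y.colIdx < (σ x).colIdx} := by
    congr 1
    ext y
    have := hne y
    simp only [Finset.mem_filter, Finset.mem_univ, true_and]
    omega
  rw [h2, ← h0] at h1
  refine h1.not_gt (Finset.card_lt_card ((Finset.ssubset_iff_of_subset fun y hy => ?_).2
    ⟨x, by simp, by simp⟩))
  simp at hy ⊢
  omega

theorem exists_eq_mul_of_separatesRows {σ : Equiv.Perm lam.Box} (hσ : SeparatesRows σ) :
    ∃ q p : Equiv.Perm lam.Box, (∀ x, (q x).colIdx = x.colIdx) ∧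
      (∀ x, (p x).rowIdx = x.rowIdx) ∧ q * p = σ := by
  choose f hr hc using exists_rowIdx_colIdx hσ
  have hf : Function.Injective f := by
    intro x y hxy
    by_contra hne
    exact hσ x y hne (by rw [← hr x, ← hr y, hxy]) (by rw [← hc x, ← hc y, hxy])
  -- `p` moves each `x` within its row to the column of `σ x`; row separation makes it injective.
  let p : Equiv.Perm lam.Box := Equiv.ofBijective f (Finite.injective_iff_bijective.1 hf)
  refine ⟨σ * p⁻¹, p, fun x => ?_, hr, by simp⟩
  obtain ⟨y, rfl⟩ := p.surjective x
  rw [Equiv.Perm.mul_apply, ← Equiv.Perm.mul_apply p⁻¹ p, inv_mul_cancel, Equiv.Perm.one_apply]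
  exact (hc y).symm

theorem eq_of_mul_eq_mul {q p q' p' : Equiv.Perm lam.Box} (hq : ∀ x, (q x).colIdx = x.colIdx)
    (hp : ∀ x, (p x).rowIdx = x.rowIdx) (hq' : ∀ x, (q' x).colIdx = x.colIdx)
    (hp' : ∀ x, (p' x).rowIdx = x.rowIdx) (h : q * p = q' * p') : q = q' ∧ p = p' := by
  have hpp : p = p' := by
    ext1 x
    refine Box.ext_idx (by rw [hp, hp']) ?_
    rw [← hq (p x), ← hq' (p' x), ← Equiv.Perm.mul_apply, h, Equiv.Perm.mul_apply]
  exact ⟨by simpa [hpp] using h, hpp⟩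

end YoungDiagram

/-! ### Coefficients and quasi-idempotence of the Young symmetrizer -/

namespace YoungDiagram

variable {lam : YoungDiagram}

theorem coeff_youngSymmetrizer (σ : Equiv.Perm lam.Box) :
    lam.youngSymmetrizer.coeff σ = (invSign σ : ℂ) := by
  classical
  have h : lam.youngSymmetrizer.coeff σ =
      ∑ q : Equiv.Perm lam.Box with ∀ x, (q x).colIdx = x.colIdx,
        ∑ p : Equiv.Perm lam.Box with ∀ x, (p x).rowIdx = x.rowIdx,
          if q * p = σ then ((Equiv.Perm.sign q : ℤ) : ℂ) else 0 := by
    rw [youngSymmetrizer, colAntisymmetrizer, rowSymmetrizer, Finset.sum_mul_sum]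
    simp [MonoidAlgebra.coeff_sum, Finsupp.finsetSum_apply, MonoidAlgebra.single_mul_single,
      Finsupp.single_apply]
  rw [h]
  by_cases hσ : SeparatesRows σ
  · obtain ⟨q, p, hq, hp, rfl⟩ := exists_eq_mul_of_separatesRows hσ
    rw [Finset.sum_eq_single_of_mem q (by simpa using hq),
      Finset.sum_eq_single_of_mem p (by simpa using hp), if_pos rfl, invSign_mul hq hp]
    · simp
    · intro p' hp' hne
      rw [if_neg]
      exact fun h => hne (mul_left_cancel h)
    · intro q' hq' hne
      refine Finset.sum_eq_zero fun p' hp' => if_neg fun h => hne ?_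
      exact (eq_of_mul_eq_mul (by simpa using hq') (by simpa using hp') hq hp h).1
  · rw [invSign, if_neg hσ, Complex.ofReal_zero]
    refine Finset.sum_eq_zero fun q hq => Finset.sum_eq_zero fun p hp => if_neg ?_
    rintro rfl
    exact hσ (separatesRows_mul (by simpa using hq) (by simpa using hp))

theorem of_mul_rowSymmetrizer {p : Equiv.Perm lam.Box} (hp : ∀ x, (p x).rowIdx = x.rowIdx) :
    MonoidAlgebra.of ℂ _ p * lam.rowSymmetrizer = lam.rowSymmetrizer := by
  rw [rowSymmetrizer, Finset.mul_sum]
  refine Finset.sum_equiv (Equiv.mulLeft p) (fun σ => ?_) fun σ _ => ?_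
  · simp [hp]
  · rw [Equiv.coe_mulLeft, map_mul]

theorem colAntisymmetrizer_mul_of {q : Equiv.Perm lam.Box}
    (hq : ∀ x, (q x).colIdx = x.colIdx) :
    lam.colAntisymmetrizer * MonoidAlgebra.of ℂ _ q =
      ((Equiv.Perm.sign q : ℤ) : ℂ) • lam.colAntisymmetrizer := by
  rw [colAntisymmetrizer, Finset.sum_mul, Finset.smul_sum]
  refine Finset.sum_equiv (Equiv.mulRight q) (fun σ => ?_) fun σ _ => ?_
  · simp only [Finset.mem_filter, Finset.mem_univ, true_and, Equiv.coe_mulRight,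
      Equiv.Perm.mul_apply]
    refine ⟨fun h x => by rw [h, hq], fun h x => ?_⟩
    obtain ⟨y, rfl⟩ := q.surjective x
    rw [h, hq]
  · rw [Equiv.coe_mulRight, smul_smul, smul_mul_assoc, ← map_mul (MonoidAlgebra.of ℂ _)]
    congr 1
    rcases Int.units_eq_one_or (Equiv.Perm.sign q) with h | h <;> simp [h]

theorem colAntisymmetrizer_mul_of_mul_rowSymmetrizer (σ : Equiv.Perm lam.Box) :
    lam.colAntisymmetrizer * MonoidAlgebra.of ℂ _ σ * lam.rowSymmetrizer =
      (invSign σ : ℂ) • lam.youngSymmetrizer := by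
  by_cases hσ : SeparatesRows σ
  · obtain ⟨q, p, hq, hp, rfl⟩ := exists_eq_mul_of_separatesRows hσ
    rw [map_mul, ← mul_assoc, colAntisymmetrizer_mul_of hq, mul_assoc, of_mul_rowSymmetrizer hp,
      invSign_mul hq hp, youngSymmetrizer, smul_mul_assoc]
    simp
  · rw [invSign, if_neg hσ, Complex.ofReal_zero, zero_smul]
    unfold SeparatesRows at hσ
    push Not at hσ
    obtain ⟨x, y, hxy, hr, hc⟩ := hσ
    have hp : ∀ z, (Equiv.swap x y z).rowIdx = z.rowIdx := by
      intro z
      rw [Equiv.swap_apply_def]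
      split_ifs with h1 h2 <;> simp_all
    have hq : ∀ z, (Equiv.swap (σ x) (σ y) z).colIdx = z.colIdx := by
      intro z
      rw [Equiv.swap_apply_def]
      split_ifs with h1 h2 <;> simp_all
    -- The swap is absorbed by `a` with sign `+1` and, moved past `σ`, by `b` with sign `-1`.
    have hcomm : σ * Equiv.swap x y = Equiv.swap (σ x) (σ y) * σ := Equiv.mul_swap_eq_swap_mul σ x y
    have h : lam.colAntisymmetrizer * MonoidAlgebra.of ℂ _ σ * lam.rowSymmetrizer =
        -(lam.colAntisymmetrizer * MonoidAlgebra.of ℂ _ σ * lam.rowSymmetrizer) := by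
      conv_lhs => rw [← of_mul_rowSymmetrizer hp, ← mul_assoc, mul_assoc lam.colAntisymmetrizer,
        ← map_mul, hcomm, map_mul, ← mul_assoc, colAntisymmetrizer_mul_of hq,
        Equiv.Perm.sign_swap (σ.injective.ne hxy)]
      simp
    have h2 := eq_neg_iff_add_eq_zero.1 h
    rw [← two_smul ℂ] at h2
    exact (smul_eq_zero.1 h2).resolve_left two_ne_zero

theorem exists_colAntisymmetrizer_mul_mul_rowSymmetrizer
    (z : MonoidAlgebra ℂ (Equiv.Perm lam.Box)) :
    ∃ k : ℂ, lam.colAntisymmetrizer * z * lam.rowSymmetrizer = k • lam.youngSymmetrizer := by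
  induction z using MonoidAlgebra.induction_on with
  | of σ => exact ⟨_, colAntisymmetrizer_mul_of_mul_rowSymmetrizer σ⟩
  | add f g hf hg =>
    obtain ⟨k, hk⟩ := hf
    obtain ⟨l, hl⟩ := hg
    exact ⟨k + l, by rw [mul_add, add_mul, hk, hl, add_smul]⟩
  | smul r f hf =>
    obtain ⟨k, hk⟩ := hf
    exact ⟨r * k, by rw [mul_smul_comm, smul_mul_assoc, hk, smul_smul]⟩

theorem exists_youngSymmetrizer_mul_self (lam : YoungDiagram) :
    ∃ k : ℂ, lam.youngSymmetrizer * lam.youngSymmetrizer = k • lam.youngSymmetrizer := by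
  obtain ⟨k, hk⟩ := exists_colAntisymmetrizer_mul_mul_rowSymmetrizer
    (lam.rowSymmetrizer * lam.colAntisymmetrizer)
  exact ⟨k, by rw [← hk, youngSymmetrizer]; simp only [mul_assoc]⟩

end YoungDiagram

/-! ### Traces and characters -/

theorem MonoidAlgebra.trace_leftRegular_comp_mulRight {k G : Type*} [Field k] [Group G] [Fintype G]
    (g : G) (c : MonoidAlgebra k G) :
    LinearMap.trace k _ (Representation.leftRegular k G g ∘ₗ LinearMap.mulRight k c) =
      ∑ h : G, c.coeff (h⁻¹ * g⁻¹ * h) := by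
  classical
  have hL : ∀ z : MonoidAlgebra k G,
      Representation.leftRegular k G g z = MonoidAlgebra.of k _ g * z := by
    intro z
    rw [← Representation.asAlgebraHom_ofMulAction_smul_eq_mul, Representation.asAlgebraHom_of]
  rw [LinearMap.trace_eq_matrix_trace k (MonoidAlgebra.basis G k), Matrix.trace]
  refine Finset.sum_congr rfl fun h _ => ?_
  rw [Matrix.diag_apply, LinearMap.toMatrix_apply, LinearMap.comp_apply, hL,
    MonoidAlgebra.basis_apply, LinearMap.mulRight_apply]
  change (MonoidAlgebra.of k G g * (single h 1 * c)).coeff h = _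
  rw [MonoidAlgebra.of_apply, MonoidAlgebra.coeff_single_mul_apply,
    MonoidAlgebra.coeff_single_mul_apply, one_mul, one_mul, mul_assoc]

namespace YoungDiagram

variable {lam : YoungDiagram}

theorem mul_character_irrep {k : ℂ}
    (hk : lam.youngSymmetrizer * lam.youngSymmetrizer = k • lam.youngSymmetrizer)
    (g : Equiv.Perm lam.Box) :
    k * lam.irrep.character g = ∑ h : Equiv.Perm lam.Box, (invSign (h⁻¹ * g⁻¹ * h) : ℂ) := by
  have : Module.Finite ℂ (MonoidAlgebra ℂ (Equiv.Perm lam.Box)) :=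
    Module.Finite.of_basis (MonoidAlgebra.basis _ ℂ)
  have : Module.Free ℂ (MonoidAlgebra ℂ (Equiv.Perm lam.Box)) :=
    Module.Free.of_basis (MonoidAlgebra.basis _ ℂ)
  set f := Representation.leftRegular ℂ _ g ∘ₗ LinearMap.mulRight ℂ lam.youngSymmetrizer with hf
  -- Since `f` maps everything into `irrepSpace`, its trace is that of its restriction, where right
  -- multiplication by `c` is the scalar `k`.
  have hmem : ∀ x, f x ∈ lam.irrepSpace := fun x =>
    lam.irrepSpace_invariant g (LinearMap.mem_range_self _ x)
  have hres : f.restrict (fun x _ => hmem x) = k • lam.irrep g := by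
    ext1 ⟨x, y, hy⟩
    refine Subtype.ext ?_
    subst hy
    change Representation.leftRegular ℂ _ g (y * lam.youngSymmetrizer * lam.youngSymmetrizer) =
      k • Representation.leftRegular ℂ _ g (y * lam.youngSymmetrizer)
    rw [mul_assoc, hk, mul_smul_comm, map_smul]
  rw [Representation.character, ← smul_eq_mul, ← map_smul, ← hres,
    LinearMap.trace_restrict_eq_of_forall_mem _ _ hmem, hf,
    MonoidAlgebra.trace_leftRegular_comp_mulRight]
  simp only [coeff_youngSymmetrizer]

theorem mul_character_irrep_one {k : ℂ}
    (hk : lam.youngSymmetrizer * lam.youngSymmetrizer = k • lam.youngSymmetrizer) :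
    k * lam.irrep.character 1 = Fintype.card (Equiv.Perm lam.Box) := by
  rw [mul_character_irrep hk]
  simp [invSign_one]

/-- The Young symmetrizer is not nilpotent: right multiplication by it has trace `n!`. -/
theorem youngSymmetrizer_scalar_ne_zero {k : ℂ}
    (hk : lam.youngSymmetrizer * lam.youngSymmetrizer = k • lam.youngSymmetrizer) : k ≠ 0 := by
  rintro rfl
  have h := mul_character_irrep_one hk
  rw [zero_mul] at h
  exact Fintype.card_ne_zero (Nat.cast_eq_zero.1 h.symm)

end YoungDiagram

/-! ### Averaging over the conjugacy class -/

theorem sum_conj_eq_card_mul_sum {G R : Type*} [Group G] [Fintype G] [DecidableEq G]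
    [CommSemiring R] (g : G) (F : G → R) (s : Finset G) (hs : ∀ x, x ∈ s ↔ IsConj g x) :
    ∑ h, F (h⁻¹ * g * h) = Finset.card {h : G | h⁻¹ * g * h = g} * ∑ x ∈ s, F x := by
  have hmaps : ∀ h ∈ (Finset.univ : Finset G), h⁻¹ * g * h ∈ s := fun h _ =>
    (hs _).2 (isConj_iff.2 ⟨h⁻¹, by simp⟩)
  rw [← Finset.sum_fiberwise_of_maps_to hmaps, Finset.mul_sum]
  refine Finset.sum_congr rfl fun x hx => ?_
  obtain ⟨c, rfl⟩ := isConj_iff.1 ((hs x).1 hx)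
  rw [Finset.sum_congr rfl fun h hh => by rw [(Finset.mem_filter.1 hh).2], Finset.sum_const,
    nsmul_eq_mul]
  congr 2
  -- The fibre over `c * g * c⁻¹` is a translate of the centralizer of `g`.
  refine Finset.card_equiv (Equiv.mulRight c) fun h => ?_
  simp only [Finset.mem_filter, Finset.mem_univ, true_and, Equiv.coe_mulRight, mul_inv_rev]
  rw [← mul_right_inj c⁻¹, ← mul_left_inj c]
  simp only [mul_assoc, inv_mul_cancel, inv_mul_cancel_left, mul_one]

theorem ProbabilityTheory.integral_uniformOn_coe {α : Type*} [Fintype α] [MeasurableSpace α]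
    [DiscreteMeasurableSpace α] (s : Finset α) (F : α → ℝ) :
    ∫ x, F x ∂(uniformOn (s : Set α)) = (s.card : ℝ)⁻¹ * ∑ x ∈ s, F x := by
  rw [uniformOn, ProbabilityTheory.cond, integral_smul_measure, Measure.count_apply_finset,
    setIntegral_finset]
  · simp [Measure.real]
  · exact (Integrable.of_finite).integrableOn

namespace YoungDiagram

/-- The inverse matches the trace formula; it is harmless because a permutation and its inverse have
the same cycle type. -/
theorem mem_boxConjClass_iff {lam : YoungDiagram} {n : ℕ} (T : Fin n ≃ lam.Box)
    (π : Equiv.Perm (Fin n)) (σ : Equiv.Perm lam.Box) :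
    σ ∈ lam.boxConjClass π ↔ IsConj (T.permCongr π)⁻¹ σ := by
  have hinv : IsConj (T.permCongr π) (T.permCongr π)⁻¹ := by
    rw [Equiv.Perm.isConj_iff_cycleType_eq, Equiv.Perm.cycleType_inv]
  have h : σ ∈ lam.boxConjClass π ↔ IsConj (T.permCongr π) σ := by
    rw [isConj_iff]
    constructor
    · rintro ⟨f, rfl⟩
      refine ⟨T.symm.trans f, ?_⟩
      ext1 x
      simp [Equiv.permCongr_apply, Equiv.Perm.inv_def]
    · rintro ⟨c, rfl⟩
      refine ⟨T.trans c, ?_⟩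
      ext1 x
      simp [Equiv.permCongr_apply, Equiv.Perm.inv_def]
  rw [h]
  exact ⟨hinv.symm.trans, hinv.trans⟩

end YoungDiagram

theorem mainTheorem3 (lam : YoungDiagram) (n : ℕ) (T : Fin n ≃ lam.Box)
    (π : Equiv.Perm (Fin n))
    [MeasurableSpace (Equiv.Perm lam.Box)] [DiscreteMeasurableSpace (Equiv.Perm lam.Box)]
    {Ω : Type*} [MeasurableSpace Ω] (P : Measure Ω) [IsProbabilityMeasure P]
    (X : Ω → Equiv.Perm lam.Box) (hX : HasLaw X (uniformOn (lam.boxConjClass π)) P) :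
    lam.normalizedCharacter T π = ((∫ ω, YoungDiagram.invSign (X ω) ∂P : ℝ) : ℂ) := by
  classical
  have hint := hX.integral_comp (f := YoungDiagram.invSign (lam := lam))
    Measurable.of_discrete.aestronglyMeasurable
  simp only [Function.comp_def] at hint
  set s : Finset (Equiv.Perm lam.Box) := (lam.boxConjClass π).toFinset with hs
  have hmem : ∀ x, x ∈ s ↔ IsConj (T.permCongr π)⁻¹ x := fun x => by
    rw [hs, Set.mem_toFinset, YoungDiagram.mem_boxConjClass_iff T]
  rw [hint, ← Set.coe_toFinset (lam.boxConjClass π), integral_uniformOn_coe]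
  obtain ⟨k, hk⟩ := lam.exists_youngSymmetrizer_mul_self
  have hk0 := YoungDiagram.youngSymmetrizer_scalar_ne_zero hk
  -- The constant function gives `n!` as centralizer order times class size, so the centralizer
  -- order cancels in the quotient.
  have hcard := sum_conj_eq_card_mul_sum (T.permCongr π)⁻¹ (fun _ => (1 : ℂ)) s hmem
  have hsum := sum_conj_eq_card_mul_sum (T.permCongr π)⁻¹
    (fun σ => (YoungDiagram.invSign σ : ℂ)) s hmem
  set N := Finset.card {h | h⁻¹ * (T.permCongr π)⁻¹ * h = (T.permCongr π)⁻¹}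
  have hN : (N : ℂ) ≠ 0 :=
    Nat.cast_ne_zero.2 (Finset.card_ne_zero.2 ⟨1, by simp⟩)
  rw [YoungDiagram.normalizedCharacter, ← mul_div_mul_left _ _ hk0,
    YoungDiagram.mul_character_irrep hk, YoungDiagram.mul_character_irrep_one hk, hsum]
  simp only [Finset.sum_const, nsmul_eq_mul, mul_one, Finset.card_univ] at hcard
  rw [hcard, mul_div_mul_left _ _ hN]
  push_cast
  rw [div_eq_inv_mul]
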